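/- For $n\ge 1$ let $X^{(n)}=(X^{(n)}_t)_{t\ge0}$ be the additive Marcus--Lushnikov process of total mass $n$: the continuous-time Markov chain on partitions of the integer $n$ (multisets of cluster sizes) that starts from $n$ clusters of size $1$ and in which each pair of clusters, of sizes $x$ and $y$, merges into one cluster of size $x+y$ at rate $(x+y)/n$. For $1\le k\le n-1$ let $S_{k,n}\ge s_{k,n}$ be the sizes of the two clusters that merge at the $k$-th jump. Given the sizes $(S_{k,n},s_{k,n})_{1\le k\le n-1}$, let $L_{1,n},\dots,L_{n-1,n}$ be independent size-biased picks: $L_{k,n}=S_{k,n}$ with probability $S_{k,n}/(S_{k,n}+s_{k,n})$ and $L_{k,n}=s_{k,n}$ with probability $s_{k,n}/(S_{k,n}+s_{k,n})$. Put \[ R_{k,n}=S_{k,n}+s_{k,n}-L_{k,n},\qquad C^{QFB}_{n,m}=\sum_{k=1}^{m}R_{k,n}. \] Then the total Quick-Find-Biased cost satisfies \[ \frac{C^{QFB}_{n,n-1}}{n\log n}\ \longrightarrow\ \frac12\quad\text{in }L^2\text{ as }n\to\infty, \qquad\text{i.e.}\qquad \mathbb E\left[\left(\frac{C^{QFB}_{n,n-1}}{n\log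 n}-\frac12\right)^{2}\right]\longrightarrow 0, \] where $\log$ is the natural logarithm. -/

import Mathlib

open MeasureTheory Filter
open scoped Topology NNReal ENNReal

noncomputable section

namespace MarcusLushnikov

/-- Merging a cluster of size `x` with a cluster of size `y`. A state is the multiset of the
cluster sizes. -/
def merge (m : Multiset ℕ) (x y : ℕ) : Multiset ℕ :=
  (m - {x, y}) + {x + y}

/-- The state reached from the monodisperse configuration (`n` clusters of size `1`) after
`k` jumps, if the jump number `i + 1` merges clusters of sizes `x i` and `y i`. -/
def clusters (n : ℕ) (x y : ℕ → ℕ) : ℕ → Multiset ℕ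
  | 0 => Multiset.replicate n 1
  | k + 1 => merge (clusters n x y k) (x k) (y k)

/-- The number of (unordered) pairs of distinct clusters of the state `m` whose sizes are `x`
and `y`. -/
def numPairs (m : Multiset ℕ) (x y : ℕ) : ℕ :=
  (m.powersetCard 2).count {x, y}

/-- The rate at which some cluster of size `x` merges with some cluster of size `y` in the
state `m`: each pair of clusters of sizes `x`, `y` merges at rate `K x y / n`. -/
def jumpRate (K : ℕ → ℕ → ℝ) (n : ℕ) (m : Multiset ℕ) (x y : ℕ) : ℝ :=
  numPairs m x y * (K x y / n)

/-- The total jump rate in the state `m`, a multiset of cluster sizes in `{1, …, n}`. -/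
def totalRate (K : ℕ → ℕ → ℝ) (n : ℕ) (m : Multiset ℕ) : ℝ :=
  ∑ x ∈ Finset.Icc 1 n, ∑ y ∈ Finset.Icc 1 x, jumpRate K n m x y

/-- The number of jumps up to time `t`, for the holding times `τ 0, τ 1, …, τ (n - 2)` of the
states visited before the `n - 1` jumps. -/
def jumpCount (n : ℕ) (τ : ℕ → ℝ) (t : ℝ≥0) : ℕ :=
  ((Finset.range (n - 1)).filter fun k => ∑ i ∈ Finset.range (k + 1), τ i ≤ t).card

/-- `X` is a Marcus–Lushnikov process with kernel `K`, of total mass `n`, started from the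
monodisperse configuration, as a continuous-time Markov chain given by its jumps and its
holding times. The jump number `k + 1` of `X` merges two clusters of sizes `S k ≥ s k`, after
`X` has spent the time `τ k` in the previous state. Given the past, in the state `m`, the holding
time is exponential with parameter `totalRate K n m` and is independent of the next pair
of sizes, which is `(x, y)` with probability `jumpRate K n m x y / totalRate K n m`; the field
`law` is the resulting joint law of the `n - 1` jumps and of the holding times. -/
structure IsMarcusLushnikov (K : ℕ → ℕ → ℝ) (n : ℕ) {Ω : Type*} [MeasurableSpace Ω]
    (P : Measure Ω) (X : ℝ≥0 → Ω → Multiset ℕ) (S s : ℕ → Ω → ℕ) (τ : ℕ → Ω → ℝ) : Prop where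
  measurable_S : ∀ k, Measurable (S k)
  measurable_s : ∀ k, Measurable (s k)
  measurable_τ : ∀ k, Measurable (τ k)
  path : ∀ᵐ ω ∂P, ∀ t, X t ω =
    clusters n (fun k => S k ω) (fun k => s k ω) (jumpCount n (fun k => τ k ω) t)
  law : ∀ (x y : ℕ → ℕ) (t : ℕ → ℝ), (∀ k, y k ≤ x k) → (∀ k, 0 ≤ t k) →
    P {ω | ∀ k < n - 1, S k ω = x k ∧ s k ω = y k ∧ t k < τ k ω} =
      ∏ k ∈ Finset.range (n - 1), ENNReal.ofReal
        (jumpRate K n (clusters n x y k) (x k) (y k) / totalRate K n (clusters n x y k) *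
          Real.exp (-totalRate K n (clusters n x y k) * t k))

/-- The additive kernel. -/
def additiveKernel (x y : ℕ) : ℝ := x + y

/-- The probability that a size-biased pick among two clusters of sizes `x` and `y` has size
`l`. -/
def sizeBiased (x y l : ℕ) : ℝ :=
  (if l = x then (x : ℝ) / (x + y) else 0) + (if l = y then (y : ℝ) / (x + y) else 0)

/-- Given the sizes `(S k, s k)` for all the `n - 1` jumps, the `L k` are independent, and `L k`
is a size-biased pick among `S k` and `s k`. -/
structure IsSizeBiasedPick (n : ℕ) {Ω : Type*} [MeasurableSpace Ω]
    (P : Measure Ω) (S s L : ℕ → Ω → ℕ) : Prop where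
  measurable_L : ∀ k, Measurable (L k)
  law : ∀ x y l : ℕ → ℕ,
    P {ω | ∀ k < n - 1, S k ω = x k ∧ s k ω = y k ∧ L k ω = l k} =
      P {ω | ∀ k < n - 1, S k ω = x k ∧ s k ω = y k} *
        ∏ k ∈ Finset.range (n - 1), ENNReal.ofReal (sizeBiased (x k) (y k) (l k))

/-- The size of the other cluster, the one that is not picked, at the jump number `k + 1`. -/
def preySize {Ω : Type*} (S s L : ℕ → Ω → ℕ) (k : ℕ) (ω : Ω) : ℝ :=
  (S k ω : ℝ) + s k ω - L k ω

/-- The cost of the first `m` jumps for Quick-Find-Biased. -/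
def costQFB {Ω : Type*} (S s L : ℕ → Ω → ℕ) (m : ℕ) (ω : Ω) : ℝ :=
  ∑ k ∈ Finset.range m, preySize S s L k ω

end MarcusLushnikov

end

/-! Let q be the sum of the squared cluster sizes divided by n². With j jumps left the total rate is
j, and the picked cluster is size-biased among all clusters while the other one is uniform among the
remaining j (`sum_pickWeight_mul`). Hence the next normalized cost R/n has conditional mean (1 -
q)/j. Heuristically q is near 0 while j is much larger than √n and near 1 once j is much smaller, so
with s = ⌊√n⌋ the compensator of the normalized cost is close to the sum of 1/j over s ≤ j < n,
which is (log n)/2 up to a constant (`abs_sum_target_sub_le`).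

Two errors must be controlled. For the martingale part, R² and LR have the same conditional mean (L
is the pick) and a merger raises q by 2LR/n², so the quadratic variation is paid for by the growth
of q/2. For the compensator, the distance to the target is q/j when j ≥ s and (1 - q)/j when j < s,
and its total, the gap, has bounded mean. Early on, the mean of q grows by a factor at most 1 + 2/j
per jump. Later, log q ≤ 0 has drift at least (1 - q)/(2j), so the remaining gap is controlled by
-log q at j = s. That is bounded in mean because log q starts at -log n and its early drift is about
2/j, with total about log n. All these estimates are merged into one supermartingale, `potential`
(`drift_inequality`, `potential_supermartingale`), which starts below 14.

Along every path the gap is at most a harmonic sum H ≤ 1 + log n, so its square is at most H times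
itself. The mean square error of the normalized cost is therefore O(log n), negligible against (log
n)² (`lintegral_cost_sub_sq_le`). -/

noncomputable section

namespace MarcusLushnikov

/-! ### Expectations of finite Markov paths as countable sums. -/

section Paths

variable {α σ : Type*}

/-- The state reached after `k` steps `a 0, …, a (k - 1)` from `s₀`, for the transition map `f`. -/
def traj (f : σ → α → σ) (s₀ : σ) (a : ℕ → α) : ℕ → σ
  | 0 => s₀
  | k + 1 => f (traj f s₀ a k) (a k)

/-- The probability of the first `j` steps of `a`, when `w` is the transition probability. -/
def pathWeight (w : σ → α → ℝ) (f : σ → α → σ) (s₀ : σ) (a : ℕ → α) (j : ℕ) : ℝ≥0∞ :=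
  ∏ k ∈ Finset.range j, ENNReal.ofReal (w (traj f s₀ a k) (a k))

/-- Extension of a finite sequence by a default value. -/
def extendPath [Inhabited α] {j : ℕ} (p : Fin j → α) (k : ℕ) : α :=
  if h : k < j then p ⟨k, h⟩ else default

/-- The expectation of `G` at the state reached after `j` steps from `s₀`. -/
def pathSum [Inhabited α] (w : σ → α → ℝ) (f : σ → α → σ) (G : σ → ℝ≥0∞) (j : ℕ) (s₀ : σ) :
    ℝ≥0∞ :=
  ∑' p : Fin j → α, pathWeight w f s₀ (extendPath p) j * G (traj f s₀ (extendPath p) j)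

lemma traj_succ_left (f : σ → α → σ) (s₀ : σ) (a : ℕ → α) (k : ℕ) :
    traj f s₀ a (k + 1) = traj f (f s₀ (a 0)) (fun i => a (i + 1)) k := by
  induction k with
  | zero => rfl
  | succ k ih => rw [traj, ih, traj]

lemma pathWeight_succ_left (w : σ → α → ℝ) (f : σ → α → σ) (s₀ : σ) (a : ℕ → α) (j : ℕ) :
    pathWeight w f s₀ a (j + 1) = ENNReal.ofReal (w s₀ (a 0)) *
      pathWeight w f (f s₀ (a 0)) (fun i => a (i + 1)) j := by
  rw [pathWeight, Finset.prod_range_succ', mul_comm]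
  simp_rw [traj_succ_left]
  rfl

lemma tsum_ofReal_mul_ofReal (A : Finset α) (u v : α → ℝ) (hu : ∀ a, 0 ≤ u a)
    (hA : ∀ a ∉ A, u a = 0) (hv : ∀ a, u a ≠ 0 → 0 ≤ v a) :
    ∑' a, ENNReal.ofReal (u a) * ENNReal.ofReal (v a) =
      ENNReal.ofReal (∑ a ∈ A, u a * v a) := by
  rw [tsum_eq_sum (s := A) (fun a ha => by simp [hA a ha]), ENNReal.ofReal_sum_of_nonneg]
  · exact Finset.sum_congr rfl fun a _ => (ENNReal.ofReal_mul (hu a)).symm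
  · intro a _
    by_cases h : u a = 0
    · simp [h]
    · exact mul_nonneg (hu a) (hv a h)

variable [Inhabited α]

lemma extendPath_of_lt {j k : ℕ} (p : Fin j → α) (h : k < j) : extendPath p k = p ⟨k, h⟩ := by
  simp [extendPath, h]

lemma extendPath_cons_zero {j : ℕ} (a : α) (p : Fin j → α) :
    extendPath (Fin.cons a p : Fin (j + 1) → α) 0 = a := by
  simp [extendPath]

lemma extendPath_cons_succ {j : ℕ} (a : α) (p : Fin j → α) :
    (fun i => extendPath (Fin.cons a p : Fin (j + 1) → α) (i + 1)) = extendPath p := by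
  funext i
  by_cases h : i < j
  · rw [extendPath_of_lt _ h, extendPath_of_lt _ (Nat.succ_lt_succ h)]
    exact Fin.cons_succ (α := fun _ => α) a p ⟨i, h⟩
  · simp [extendPath, h]

lemma pathSum_zero (w : σ → α → ℝ) (f : σ → α → σ) (G : σ → ℝ≥0∞) (s₀ : σ) :
    pathSum w f G 0 s₀ = G s₀ := by
  simp [pathSum, pathWeight, traj]

/-- First-step decomposition: conditioning on the first step turns bounds on expectations into
inductions on the number of remaining jumps. -/
lemma pathSum_succ (w : σ → α → ℝ) (f : σ → α → σ) (G : σ → ℝ≥0∞) (j : ℕ) (s₀ : σ) :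
    pathSum w f G (j + 1) s₀ = ∑' a, ENNReal.ofReal (w s₀ a) * pathSum w f G j (f s₀ a) := by
  rw [pathSum, ← (Fin.consEquiv (fun _ : Fin (j + 1) => α)).tsum_eq, ENNReal.tsum_prod']
  refine tsum_congr fun a => ?_
  rw [pathSum, ← ENNReal.tsum_mul_left]
  refine tsum_congr fun p => ?_
  have hc : (Fin.consEquiv (fun _ : Fin (j + 1) => α)) (a, p) = Fin.cons a p := rfl
  rw [hc, pathWeight_succ_left, traj_succ_left, extendPath_cons_zero, extendPath_cons_succ,
    mul_assoc]

/-- The path probabilities add up to one. -/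
lemma pathSum_one_eq_one {w : σ → α → ℝ} {f : σ → α → σ} {Inv : ℕ → σ → Prop}
    (A : σ → Finset α) (hw : ∀ s a, 0 ≤ w s a)
    (hA : ∀ j s, Inv (j + 1) s → ∀ a ∉ A s, w s a = 0)
    (hInv : ∀ j s a, Inv (j + 1) s → w s a ≠ 0 → Inv j (f s a))
    (hsum : ∀ j s, Inv (j + 1) s → ∑ a ∈ A s, w s a = 1) (j : ℕ) (s : σ) (hs : Inv j s) :
    pathSum w f (fun _ => 1) j s = 1 := by
  induction j generalizing s with
  | zero => rw [pathSum_zero]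
  | succ j ih =>
    have : ∀ a, ENNReal.ofReal (w s a) * pathSum w f (fun _ => 1) j (f s a) =
        ENNReal.ofReal (w s a) * ENNReal.ofReal 1 := by
      intro a
      by_cases h : w s a = 0
      · simp [h]
      · rw [ih _ (hInv j s a hs h), ENNReal.ofReal_one]
    rw [pathSum_succ, tsum_congr this, tsum_ofReal_mul_ofReal (A s) _ (fun _ => 1) (hw s)
      (hA j s hs) (fun _ _ => zero_le_one)]
    simp [hsum j s hs]

/-- A supermartingale bounds the expectation of what its terminal value bounds. -/
lemma pathSum_le_of_supermartingale {w : σ → α → ℝ} {f : σ → α → σ} {Inv : ℕ → σ → Prop}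
    (A : σ → Finset α) (G : σ → ℝ) (Ψ : ℕ → σ → ℝ) (hw : ∀ s a, 0 ≤ w s a)
    (hA : ∀ j s, Inv (j + 1) s → ∀ a ∉ A s, w s a = 0)
    (hInv : ∀ j s a, Inv (j + 1) s → w s a ≠ 0 → Inv j (f s a))
    (hG : ∀ s, Inv 0 s → 0 ≤ G s ∧ G s ≤ Ψ 0 s)
    (hstep : ∀ j s, Inv (j + 1) s → ∑ a ∈ A s, w s a * Ψ j (f s a) ≤ Ψ (j + 1) s)
    (j : ℕ) (s : σ) (hs : Inv j s) :
    0 ≤ Ψ j s ∧ pathSum w f (fun s => ENNReal.ofReal (G s)) j s ≤ ENNReal.ofReal (Ψ j s) := by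
  induction j generalizing s with
  | zero =>
    rw [pathSum_zero]
    exact ⟨(hG s hs).1.trans (hG s hs).2, ENNReal.ofReal_le_ofReal (hG s hs).2⟩
  | succ j ih =>
    -- Nonnegativity of `Ψ` is carried along because `ENNReal.ofReal` truncates negative values:
    -- without it the one-step inequality would not transfer.
    constructor
    · refine le_trans (Finset.sum_nonneg fun a _ => ?_) (hstep j s hs)
      by_cases h : w s a = 0
      · simp [h]
      · exact mul_nonneg (hw s a) (ih _ (hInv j s a hs h)).1
    · rw [pathSum_succ]
      refine le_trans (ENNReal.tsum_le_tsum (g := fun a => ENNReal.ofReal (w s a) *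
        ENNReal.ofReal (Ψ j (f s a))) fun a => ?_) ?_
      · by_cases h : w s a = 0
        · simp [h]
        · exact mul_le_mul_right (ih _ (hInv j s a hs h)).2 _
      · rw [tsum_ofReal_mul_ofReal (A s) _ _ (hw s) (hA j s hs)
          fun a h => (ih _ (hInv j s a hs h)).1]
        exact ENNReal.ofReal_le_ofReal (hstep j s hs)

end Paths

/-! ### Sums over pairs of clusters and power sums. -/

section Pairs

/-- The sum of `φ x y` over the ordered pairs of distinct members of `m`. -/
def offDiag (m : Multiset ℕ) (φ : ℕ → ℕ → ℝ) : ℝ :=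
  (m.map fun x => (m.map fun y => φ x y).sum).sum - (m.map fun x => φ x x).sum

/-- The power sum of order `k` of the cluster sizes. -/
def powerSum (k : ℕ) (m : Multiset ℕ) : ℝ := (m.map fun x : ℕ => (x : ℝ) ^ k).sum

lemma sum_map_pow (k : ℕ) (m : Multiset ℕ) :
    (m.map fun x : ℕ => (x : ℝ) ^ k).sum = powerSum k m := rfl

lemma powerSum_zero (m : Multiset ℕ) : powerSum 0 m = m.card := by
  simp [powerSum]

lemma powerSum_one (m : Multiset ℕ) : powerSum 1 m = (m.sum : ℕ) := by
  simp [powerSum]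

lemma offDiag_cons (a : ℕ) (m : Multiset ℕ) (φ : ℕ → ℕ → ℝ) (hφ : ∀ x y, φ x y = φ y x) :
    offDiag (a ::ₘ m) φ = 2 * (m.map fun b => φ a b).sum + offDiag m φ := by
  simp only [offDiag, Multiset.map_cons, Multiset.sum_cons, Multiset.sum_map_add]
  rw [Multiset.map_congr rfl fun x _ => hφ x a]
  ring

lemma pair_eq_pair_iff {a b x y : ℕ} (h : y ≤ x) :
    ({x, y} : Multiset ℕ) = {a, b} ↔ x = max a b ∧ y = min a b := by
  have key : ({x, y} : Multiset ℕ) = {a, b} ↔ (x = a ∧ y = b) ∨ (x = b ∧ y = a) := by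
    constructor
    · intro h
      have h' : x ::ₘ {y} = a ::ₘ {b} := h
      rw [Multiset.cons_eq_cons] at h'
      rcases h' with ⟨h1, h2⟩ | ⟨_, cs, h2, h3⟩
      · exact Or.inl ⟨h1, by simpa using h2⟩
      · right
        rw [Multiset.singleton_eq_cons_iff] at h2 h3
        exact ⟨h3.1.symm, h2.1⟩
    · rintro (⟨rfl, rfl⟩ | ⟨rfl, rfl⟩)
      · rfl
      · exact Multiset.pair_comm _ _
  rw [key]
  omega

/-- A pair either avoids the new member or joins it to one old member; the sorted form of the latter
is (max, min). -/
lemma numPairs_cons (a : ℕ) (m : Multiset ℕ) {x y : ℕ} (h : y ≤ x) :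
    (numPairs (a ::ₘ m) x y : ℝ) = numPairs m x y +
      (m.map fun b => if x = max a b ∧ y = min a b then (1 : ℝ) else 0).sum := by
  have h1 : (Multiset.powersetCard 1 m).map (Multiset.cons a) = m.map fun b => {a, b} := by
    rw [Multiset.powersetCard_one, Multiset.map_map]
    rfl
  rw [numPairs, Multiset.powersetCard_cons, Multiset.count_add, h1, Nat.cast_add, numPairs]
  congr 1
  clear h1
  rw [Multiset.count_map]
  simp only [pair_eq_pair_iff h]
  induction m using Multiset.induction_on with
  | empty => simp
  | cons c m ih =>
    rw [Multiset.map_cons, Multiset.sum_cons, ← ih, Multiset.filter_cons]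
    split_ifs <;> simp [add_comm]

lemma sum_indicator_pairs (n a : ℕ) (ha : a ∈ Finset.Icc 1 n) (m : Multiset ℕ)
    (φ : ℕ → ℕ → ℝ) (hφ : ∀ x y, φ x y = φ y x) (hm : ∀ x ∈ m, x ∈ Finset.Icc 1 n) :
    ∑ x ∈ Finset.Icc 1 n, ∑ y ∈ Finset.Icc 1 x,
      (m.map fun b => if x = max a b ∧ y = min a b then (1 : ℝ) else 0).sum * φ x y =
      (m.map fun b => φ a b).sum := by
  induction m using Multiset.induction_on with
  | empty => simp
  | cons c m ih =>
    have hc := hm c (Multiset.mem_cons_self c m)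
    simp only [Multiset.map_cons, Multiset.sum_cons, add_mul, Finset.sum_add_distrib]
    rw [ih fun x hx => hm x (Multiset.mem_cons_of_mem hx)]
    congr 1
    rw [Finset.mem_Icc] at ha hc
    rw [Finset.sum_eq_single (max a c), Finset.sum_eq_single (min a c)]
    · rcases le_total a c with h | h
      · simp [h, hφ a c]
      · simp [h]
    · intro y _ hy
      simp [hy]
    · intro h
      exact absurd (Finset.mem_Icc.2 (by omega)) h
    · intro x _ hx
      simp [hx]
    · intro h
      exact absurd (Finset.mem_Icc.2 (by omega)) h

/-- The sum over the unordered pairs of clusters, as a sum over the ordered pairs. -/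
lemma two_mul_sum_numPairs (n : ℕ) (m : Multiset ℕ) (φ : ℕ → ℕ → ℝ)
    (hφ : ∀ x y, φ x y = φ y x) (hm : ∀ x ∈ m, x ∈ Finset.Icc 1 n) :
    2 * ∑ x ∈ Finset.Icc 1 n, ∑ y ∈ Finset.Icc 1 x, (numPairs m x y : ℝ) * φ x y =
      offDiag m φ := by
  induction m using Multiset.induction_on with
  | empty =>
    have : ∀ x y : ℕ, numPairs 0 x y = 0 := fun x y => by
      simp [numPairs, Multiset.powersetCard_zero_right]
    simp [this, offDiag]
  | cons a m ih =>
    have hma : a ∈ Finset.Icc 1 n := hm a (Multiset.mem_cons_self a m)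
    have hmm : ∀ x ∈ m, x ∈ Finset.Icc 1 n := fun x hx => hm x (Multiset.mem_cons_of_mem hx)
    rw [offDiag_cons a m φ hφ, ← ih hmm, ← mul_add, ← sum_indicator_pairs n a hma m φ hφ hmm,
      ← Finset.sum_add_distrib]
    congr 1
    refine Finset.sum_congr rfl fun x _ => ?_
    rw [← Finset.sum_add_distrib]
    refine Finset.sum_congr rfl fun y hy => ?_
    rw [numPairs_cons a m (Finset.mem_Icc.1 hy).2]
    ring

/-- The outer factor x is the size bias of the pick, and the monomials are those left in the
potential once the logarithm is bounded by a quadratic. The terms `c₂` and `c₃` have equal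
coefficients: this is the equality of the means of R² and LR. -/
lemma offDiag_polynomial (m : Multiset ℕ) (c₀ c₁ c₂ c₃ c₄ : ℝ) :
    offDiag m (fun x y => (x : ℝ) *
      (c₀ + c₁ * y + c₂ * (y : ℝ) ^ 2 + c₃ * (x * y) + c₄ * ((x : ℝ) * y) ^ 2)) =
    c₀ * (powerSum 1 m * powerSum 0 m - powerSum 1 m) +
      c₁ * (powerSum 1 m ^ 2 - powerSum 2 m) +
      c₂ * (powerSum 1 m * powerSum 2 m - powerSum 3 m) +
      c₃ * (powerSum 2 m * powerSum 1 m - powerSum 3 m) +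
      c₄ * (powerSum 3 m * powerSum 2 m - powerSum 5 m) := by
  have e1 : ∀ x : ℕ, (m.map fun y : ℕ => (x : ℝ) *
      (c₀ + c₁ * y + c₂ * (y : ℝ) ^ 2 + c₃ * (x * y) + c₄ * ((x : ℝ) * y) ^ 2)).sum =
      (c₀ * powerSum 0 m + c₁ * powerSum 1 m + c₂ * powerSum 2 m) * (x : ℝ) ^ 1 +
        (c₃ * powerSum 1 m) * (x : ℝ) ^ 2 + (c₄ * powerSum 2 m) * (x : ℝ) ^ 3 := by
    intro x
    have : ∀ y : ℕ, (x : ℝ) *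
        (c₀ + c₁ * y + c₂ * (y : ℝ) ^ 2 + c₃ * (x * y) + c₄ * ((x : ℝ) * y) ^ 2) =
        (x * c₀) * (y : ℝ) ^ 0 + (x * c₁ + x ^ 2 * c₃) * (y : ℝ) ^ 1 +
          (x * c₂ + x ^ 3 * c₄) * (y : ℝ) ^ 2 := fun y => by ring
    simp only [this, Multiset.sum_map_add, Multiset.sum_map_mul_left, sum_map_pow]
    ring
  have e2 : ∀ x : ℕ, (x : ℝ) *
      (c₀ + c₁ * x + c₂ * (x : ℝ) ^ 2 + c₃ * (x * x) + c₄ * ((x : ℝ) * x) ^ 2) =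
      c₀ * (x : ℝ) ^ 1 + c₁ * (x : ℝ) ^ 2 + (c₂ + c₃) * (x : ℝ) ^ 3 + c₄ * (x : ℝ) ^ 5 :=
    fun x => by ring
  simp only [offDiag, e1, e2, Multiset.sum_map_add, Multiset.sum_map_mul_left, sum_map_pow]
  ring

end Pairs

/-! ### Reachable states and the total rate. -/

section States

/-- `m` is a state of total mass `n` from which `j` jumps remain. -/
structure IsState (n j : ℕ) (m : Multiset ℕ) : Prop where
  card_eq : m.card = j + 1
  sum_eq : m.sum = n
  pos : ∀ x ∈ m, 1 ≤ x

lemma IsState.mem_Icc {n j : ℕ} {m : Multiset ℕ} (h : IsState n j m) {x : ℕ} (hx : x ∈ m) :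
    x ∈ Finset.Icc 1 n :=
  Finset.mem_Icc.2 ⟨h.pos x hx, h.sum_eq ▸ Multiset.le_sum_of_mem hx⟩

lemma isState_replicate {n : ℕ} (hn : 1 ≤ n) : IsState n (n - 1) (Multiset.replicate n 1) where
  card_eq := by rw [Multiset.card_replicate]; omega
  sum_eq := by simp
  pos := fun x hx => (Multiset.eq_of_mem_replicate hx).ge

lemma pair_le_of_numPairs_ne_zero {m : Multiset ℕ} {x y : ℕ} (h : numPairs m x y ≠ 0) :
    ({x, y} : Multiset ℕ) ≤ m :=
  (Multiset.mem_powersetCard.1 (Multiset.count_ne_zero.1 h)).1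

lemma IsState.merge {n j : ℕ} {m : Multiset ℕ} (h : IsState n (j + 1) m) {x y : ℕ}
    (hxy : ({x, y} : Multiset ℕ) ≤ m) : IsState n j (merge m x y) := by
  obtain ⟨r, rfl⟩ := Multiset.le_iff_exists_add.1 hxy
  have hc := h.card_eq
  have hs := h.sum_eq
  have hp := h.pos
  rw [MarcusLushnikov.merge, add_tsub_cancel_left]
  simp only [Multiset.card_add, Multiset.card_pair, Multiset.sum_add, Multiset.sum_pair] at hc hs
  refine ⟨?_, ?_, ?_⟩
  · simp only [Multiset.card_add, Multiset.card_singleton]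
    omega
  · simp only [Multiset.sum_add, Multiset.sum_singleton]
    omega
  · intro z hz
    rcases Multiset.mem_add.1 hz with hz | hz
    · exact hp z (Multiset.mem_add.2 (Or.inr hz))
    · rw [Multiset.mem_singleton] at hz
      have := hp x (by simp)
      omega

lemma powerSum_two_merge {m : Multiset ℕ} {x y : ℕ} (hxy : ({x, y} : Multiset ℕ) ≤ m) :
    powerSum 2 (MarcusLushnikov.merge m x y) = powerSum 2 m + 2 * (x * y) := by
  obtain ⟨r, rfl⟩ := Multiset.le_iff_exists_add.1 hxy
  rw [MarcusLushnikov.merge, add_tsub_cancel_left]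
  simp [powerSum]
  ring

/-- Through 2xy ≤ x² + y², this keeps the relative increase of `powerSum 2` at a merger within [0,
1], where the bounds on log(1 + x) are applied. -/
lemma sq_add_sq_le_powerSum_two {m : Multiset ℕ} {x y : ℕ} (hxy : ({x, y} : Multiset ℕ) ≤ m) :
    (x : ℝ) ^ 2 + (y : ℝ) ^ 2 ≤ powerSum 2 m := by
  obtain ⟨r, rfl⟩ := Multiset.le_iff_exists_add.1 hxy
  have : 0 ≤ (r.map fun x : ℕ => (x : ℝ) ^ 2).sum :=
    Multiset.sum_nonneg fun z hz => by
      obtain ⟨k, _, rfl⟩ := Multiset.mem_map.1 hz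
      positivity
  simp [powerSum]
  linarith

/-- The total rate of the additive kernel. -/
lemma IsState.totalRate_eq {n j : ℕ} {m : Multiset ℕ} (h : IsState n j m) (hn : 1 ≤ n) :
    totalRate additiveKernel n m = j := by
  have key := two_mul_sum_numPairs n m (fun x y => additiveKernel x y / n)
    (fun x y => by simp [additiveKernel, add_comm]) (fun x hx => h.mem_Icc hx)
  have e : ∀ x y : ℕ, additiveKernel x y / n = (1 / n : ℝ) * (x : ℝ) ^ 1 +
    (1 / n : ℝ) * (y : ℝ) ^ 1 := fun x y => by simp [additiveKernel]; ring
  have hn' : (n : ℝ) ≠ 0 := by positivity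
  have h0 := powerSum_zero m
  have h1 := powerSum_one m
  rw [h.card_eq] at h0
  rw [h.sum_eq] at h1
  have hr : offDiag m (fun x y => additiveKernel x y / n) = 2 * j := by
    have c : ∀ c : ℝ, (m.map fun _ => c).sum = c * (j + 1) := fun c => by
      simp [h.card_eq]; ring
    simp only [offDiag, e, Multiset.sum_map_add, Multiset.sum_map_mul_left, Multiset.sum_map_mul_right, sum_map_pow, c, h1]
    field_simp
    ring
  rw [hr] at key
  simp only [totalRate, jumpRate]
  linarith

end States

/-! ### Law of one jump together with its size-biased pick. -/

section OneStep

/-- The probability that the next jump merges clusters of sizes `a.1 ≥ a.2`. -/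
def pairWeight (n : ℕ) (m : Multiset ℕ) (a : ℕ × ℕ) : ℝ :=
  if a.2 ≤ a.1 then jumpRate additiveKernel n m a.1 a.2 / totalRate additiveKernel n m else 0

/-- The probability that the next jump merges clusters of sizes `a.1.1 ≥ a.1.2`, and that the
size-biased pick has size `a.2`. -/
def pickWeight (n : ℕ) (m : Multiset ℕ) (a : (ℕ × ℕ) × ℕ) : ℝ :=
  pairWeight n m a.1 * sizeBiased a.1.1 a.1.2 a.2

lemma jumpRate_nonneg (n : ℕ) (m : Multiset ℕ) (x y : ℕ) :
    0 ≤ jumpRate additiveKernel n m x y := by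
  rw [jumpRate, additiveKernel]
  positivity

lemma pairWeight_nonneg (n : ℕ) (m : Multiset ℕ) (a : ℕ × ℕ) : 0 ≤ pairWeight n m a := by
  rw [pairWeight]
  split_ifs
  · exact div_nonneg (jumpRate_nonneg _ _ _ _)
      (Finset.sum_nonneg fun x _ => Finset.sum_nonneg fun y _ => jumpRate_nonneg _ _ _ _)
  · exact le_rfl

lemma sizeBiased_nonneg (x y l : ℕ) : 0 ≤ sizeBiased x y l := by
  rw [sizeBiased]
  split_ifs <;> positivity

lemma pickWeight_nonneg (n : ℕ) (m : Multiset ℕ) (a : (ℕ × ℕ) × ℕ) : 0 ≤ pickWeight n m a :=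
  mul_nonneg (pairWeight_nonneg _ _ _) (sizeBiased_nonneg _ _ _)

lemma pair_le_of_pairWeight_ne_zero {n : ℕ} {m : Multiset ℕ} {a : ℕ × ℕ}
    (h : pairWeight n m a ≠ 0) : ({a.1, a.2} : Multiset ℕ) ≤ m := by
  apply pair_le_of_numPairs_ne_zero
  intro h0
  exact h (by simp [pairWeight, jumpRate, h0])

lemma eq_or_eq_of_pickWeight_ne_zero {n : ℕ} {m : Multiset ℕ} {a : (ℕ × ℕ) × ℕ}
    (h : pickWeight n m a ≠ 0) : a.2 = a.1.1 ∨ a.2 = a.1.2 := by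
  by_contra! h0
  exact h (by simp [pickWeight, sizeBiased, h0.1, h0.2])

lemma pairWeight_ne_zero_of_pickWeight_ne_zero {n : ℕ} {m : Multiset ℕ} {a : (ℕ × ℕ) × ℕ}
    (h : pickWeight n m a ≠ 0) : pairWeight n m a.1 ≠ 0 :=
  left_ne_zero_of_mul h

/-- The pairs of possible cluster sizes. -/
def pairSupport (n : ℕ) : Finset (ℕ × ℕ) := Finset.Icc 1 n ×ˢ Finset.Icc 1 n

/-- The possible cluster sizes and picks. -/
def pickSupport (n : ℕ) : Finset ((ℕ × ℕ) × ℕ) := pairSupport n ×ˢ Finset.Icc 1 n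

lemma IsState.mem_pairSupport {n j : ℕ} {m : Multiset ℕ} (h : IsState n j m) {a : ℕ × ℕ}
    (ha : pairWeight n m a ≠ 0) : a ∈ pairSupport n := by
  have hle := pair_le_of_pairWeight_ne_zero ha
  exact Finset.mem_product.2 ⟨h.mem_Icc (Multiset.mem_of_le hle (by simp)),
    h.mem_Icc (Multiset.mem_of_le hle (by simp))⟩

lemma IsState.mem_pickSupport {n j : ℕ} {m : Multiset ℕ} (h : IsState n j m)
    {a : (ℕ × ℕ) × ℕ} (ha : pickWeight n m a ≠ 0) : a ∈ pickSupport n := by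
  have h1 := h.mem_pairSupport (pairWeight_ne_zero_of_pickWeight_ne_zero ha)
  refine Finset.mem_product.2 ⟨h1, ?_⟩
  rcases eq_or_eq_of_pickWeight_ne_zero ha with h2 | h2
  · exact h2 ▸ (Finset.mem_product.1 h1).1
  · exact h2 ▸ (Finset.mem_product.1 h1).2

lemma sum_pairWeight_mul {n j : ℕ} {m : Multiset ℕ} (h : IsState n j m) (hn : 1 ≤ n)
    (g : ℕ → ℕ → ℝ) :
    ∑ a ∈ pairSupport n, pairWeight n m a * g a.1 a.2 =
      (∑ x ∈ Finset.Icc 1 n, ∑ y ∈ Finset.Icc 1 x,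
        (numPairs m x y : ℝ) * (((x : ℝ) + y) * g x y)) / (n * j) := by
  rw [pairSupport, Finset.sum_product, Finset.sum_div]
  refine Finset.sum_congr rfl fun x hx => ?_
  rw [Finset.mem_Icc] at hx
  have hf : Finset.Icc 1 x = (Finset.Icc 1 n).filter fun y => y ≤ x := by
    ext y
    simp only [Finset.mem_Icc, Finset.mem_filter]
    omega
  rw [hf, Finset.sum_filter, Finset.sum_div]
  refine Finset.sum_congr rfl fun y _ => ?_
  simp only [pairWeight, h.totalRate_eq hn, jumpRate, additiveKernel]
  split_ifs
  · ring
  · simp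

/-- The factor x + y of the additive rate cancels the denominator of the size bias. This also holds
when x = y, where both indicators contribute. -/
lemma sum_sizeBiased_mul {n x y : ℕ} (hx : x ∈ Finset.Icc 1 n) (hy : y ∈ Finset.Icc 1 n)
    (H : ℕ → ℕ → ℝ) :
    ((x : ℝ) + y) * ∑ l ∈ Finset.Icc 1 n, sizeBiased x y l * H l (x + y - l) =
      x * H x y + y * H y x := by
  have hxy : (x : ℝ) + y ≠ 0 := by
    have := (Finset.mem_Icc.1 hx).1
    positivity
  simp only [sizeBiased, add_mul, ite_mul, zero_mul, Finset.sum_add_distrib, Finset.sum_ite_eq',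
    hx, hy, if_true, Nat.add_sub_cancel_left, Nat.add_sub_cancel]
  field_simp

/-- The picked cluster is size-biased, and the other one is uniform among the rest. -/
lemma sum_pickWeight_mul {n j : ℕ} {m : Multiset ℕ} (h : IsState n j m) (hn : 1 ≤ n)
    (H : ℕ → ℕ → ℝ) :
    ∑ a ∈ pickSupport n, pickWeight n m a * H a.2 (a.1.1 + a.1.2 - a.2) =
      offDiag m (fun x y => (x : ℝ) * H x y) / (n * j) := by
  have e : ∀ a ∈ pairSupport n, ∑ l ∈ Finset.Icc 1 n, pickWeight n m (a, l) *
      H l (a.1 + a.2 - l) = pairWeight n m a *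
        ∑ l ∈ Finset.Icc 1 n, sizeBiased a.1 a.2 l * H l (a.1 + a.2 - l) := by
    intro a _
    simp only [pickWeight, Finset.mul_sum, mul_assoc]
  rw [pickSupport, Finset.sum_product, Finset.sum_congr rfl e, sum_pairWeight_mul h hn fun x y =>
    ∑ l ∈ Finset.Icc 1 n, sizeBiased x y l * H l (x + y - l)]
  congr 1
  have key := two_mul_sum_numPairs n m (fun x y => x * H x y + y * H y x)
    (fun x y => add_comm _ _) (fun x hx => h.mem_Icc hx)
  have e2 : offDiag m (fun x y => x * H x y + y * H y x) =
      2 * offDiag m (fun x y => (x : ℝ) * H x y) := by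
    have := Multiset.sum_map_sum_map m m (f := fun x y : ℕ => (x : ℝ) * H x y)
    simp only [offDiag, Multiset.sum_map_add]
    rw [this]
    ring
  rw [e2] at key
  have e3 : ∑ x ∈ Finset.Icc 1 n, ∑ y ∈ Finset.Icc 1 x, (numPairs m x y : ℝ) *
      (((x : ℝ) + y) * ∑ l ∈ Finset.Icc 1 n, sizeBiased x y l * H l (x + y - l)) =
      ∑ x ∈ Finset.Icc 1 n, ∑ y ∈ Finset.Icc 1 x, (numPairs m x y : ℝ) *
        (x * H x y + y * H y x) := by
    refine Finset.sum_congr rfl fun x hx => Finset.sum_congr rfl fun y hy => ?_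
    rw [sum_sizeBiased_mul hx]
    rw [Finset.mem_Icc] at hx hy ⊢
    omega
  rw [e3]
  linarith

lemma sum_pairWeight {n j : ℕ} {m : Multiset ℕ} (h : IsState n (j + 1) m) (hn : 1 ≤ n) :
    ∑ a ∈ pairSupport n, pairWeight n m a = 1 := by
  have key := sum_pairWeight_mul h hn fun _ _ => 1
  simp only [mul_one] at key
  rw [key]
  have ht := h.totalRate_eq hn
  simp only [totalRate, jumpRate, additiveKernel] at ht
  have hn' : (n : ℝ) ≠ 0 := by positivity
  rw [div_eq_one_iff_eq (by positivity), ← ht, Finset.mul_sum]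
  refine Finset.sum_congr rfl fun x _ => ?_
  rw [Finset.mul_sum]
  refine Finset.sum_congr rfl fun y _ => ?_
  field_simp

/-- The expectation of a polynomial in the sizes of the two clusters that merge. -/
lemma sum_pickWeight_mul_polynomial {n j : ℕ} {m : Multiset ℕ} (h : IsState n (j + 1) m)
    (hn : 1 ≤ n) (c₀ c₁ c₂ c₃ c₄ : ℝ) :
    ∑ a ∈ pickSupport n, pickWeight n m a *
      (c₀ + c₁ * (a.1.1 + a.1.2 - a.2 : ℕ) + c₂ * ((a.1.1 + a.1.2 - a.2 : ℕ) : ℝ) ^ 2 +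
        c₃ * (a.2 * (a.1.1 + a.1.2 - a.2 : ℕ)) +
        c₄ * ((a.2 : ℝ) * (a.1.1 + a.1.2 - a.2 : ℕ)) ^ 2) =
    c₀ + c₁ * ((n ^ 2 - powerSum 2 m) / (n * (j + 1))) +
      (c₂ + c₃) * ((n * powerSum 2 m - powerSum 3 m) / (n * (j + 1))) +
      c₄ * ((powerSum 3 m * powerSum 2 m - powerSum 5 m) / (n * (j + 1))) := by
  have hn' : (n : ℝ) ≠ 0 := by positivity
  have hj : (j : ℝ) + 1 ≠ 0 := by positivity
  refine (sum_pickWeight_mul h hn fun x y : ℕ => c₀ + c₁ * y + c₂ * (y : ℝ) ^ 2 +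
    c₃ * (x * y) + c₄ * ((x : ℝ) * y) ^ 2).trans ?_
  rw [offDiag_polynomial, powerSum_zero, powerSum_one, h.card_eq,
    h.sum_eq]
  push_cast
  field_simp
  ring

lemma powerSum_nonneg (k : ℕ) (m : Multiset ℕ) : 0 ≤ powerSum k m :=
  Multiset.sum_nonneg fun z hz => by
    obtain ⟨k, _, rfl⟩ := Multiset.mem_map.1 hz
    positivity

lemma IsState.powerSum_two_le {n j : ℕ} {m : Multiset ℕ} (h : IsState n j m) :
    powerSum 2 m ≤ (n : ℝ) ^ 2 := by
  have : powerSum 2 m ≤ (m.map fun x : ℕ => (n : ℝ) * (x : ℝ) ^ 1).sum := by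
    refine Multiset.sum_map_le_sum_map _ _ fun x hx => ?_
    have : (x : ℝ) ≤ n := by exact_mod_cast (Finset.mem_Icc.1 (h.mem_Icc hx)).2
    nlinarith [(Nat.cast_nonneg x : (0 : ℝ) ≤ x)]
  rw [Multiset.sum_map_mul_left, sum_map_pow, powerSum_one, h.sum_eq] at this
  linarith

lemma IsState.powerSum_two_pos {n j : ℕ} {m : Multiset ℕ} (h : IsState n j m) :
    0 < powerSum 2 m := by
  have : powerSum 0 m ≤ powerSum 2 m := by
    refine Multiset.sum_map_le_sum_map _ _ fun x hx => ?_
    have : (1 : ℝ) ≤ x := by exact_mod_cast h.pos x hx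
    exact pow_le_pow_right₀ this (by norm_num)
  rw [powerSum_zero, h.card_eq] at this
  have h2 : (0 : ℝ) < ((j + 1 : ℕ) : ℝ) := by positivity
  linarith

lemma IsState.lt {n j : ℕ} {m : Multiset ℕ} (h : IsState n j m) : j < n := by
  have : (m.map fun _ => 1).sum ≤ (m.map fun x : ℕ => x).sum :=
    Multiset.sum_map_le_sum_map _ _ fun x hx => h.pos x hx
  simp [h.card_eq, h.sum_eq] at this
  omega

/-- No size exceeds the square root of the sum of squares. This gives κ ≤ √q in `drift_inequality`.
-/
lemma powerSum_three_le (m : Multiset ℕ) :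
    powerSum 3 m ≤ √(powerSum 2 m) * powerSum 2 m := by
  have : powerSum 3 m ≤ (m.map fun x : ℕ => √(powerSum 2 m) * (x : ℝ) ^ 2).sum := by
    refine Multiset.sum_map_le_sum_map _ _ fun x hx => ?_
    have h1 : (x : ℝ) ≤ √(powerSum 2 m) := by
      apply Real.le_sqrt_of_sq_le
      refine Multiset.single_le_sum (fun z hz => ?_) _ (Multiset.mem_map.2 ⟨x, hx, rfl⟩)
      obtain ⟨k, _, rfl⟩ := Multiset.mem_map.1 hz
      positivity
    calc (x : ℝ) ^ 3 = x * (x : ℝ) ^ 2 := by ring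
      _ ≤ _ := by gcongr
  rwa [Multiset.sum_map_mul_left, sum_map_pow] at this

end OneStep

/-! ### The supermartingale controlling fluctuations and compensator. -/

section Potential

/-- The deterministic approximation of the mean normalized cost of a jump, when `j` jumps
remain. -/
def target (s j : ℕ) : ℝ := if s ≤ j then 1 / j else 0

/-- The coefficient of `∑ (x / n) ^ 2` in the potential. -/
def slope (s j : ℕ) : ℝ :=
  if s ≤ j + 1 then 5 * (j + 1) * (j + 1 - s) / (s * (s + 1)) else 0

/-- The constant term of the potential. -/
def offset (s j : ℕ) : ℝ :=
  if s ≤ j + 1 then -4 * Real.log ((j + 1) / s) + 8 * s * (1 / s - 1 / (j + 1)) else 0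

lemma slope_nonneg (s j : ℕ) : 0 ≤ slope s j := by
  rw [slope]
  split_ifs with h
  · have : (s : ℝ) ≤ j + 1 := by exact_mod_cast h
    have : (0 : ℝ) ≤ j + 1 - s := by linarith
    positivity
  · exact le_rfl

/-- `slope` solves the recursion slope(j)(1 + 2/(j+1)) = slope(j+1) - 5/s. Of the 5q/s released, one
part pays for the gap q/(j+1) ≤ q/s and four for the error of the logarithm. -/
lemma slope_add_le {s j : ℕ} (hs : 1 ≤ s) (h : s ≤ j + 1) {q : ℝ} (hq : 0 ≤ q) :
    q / (j + 1) + 4 * q / s + slope s j * (q + 2 * q / (j + 1)) ≤ slope s (j + 1) * q := by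
  have hs' : (0 : ℝ) < s := by exact_mod_cast hs
  have hj : (s : ℝ) ≤ j + 1 := by exact_mod_cast h
  rw [slope, slope, if_pos h, if_pos (by omega)]
  have h1 : q / ((j : ℝ) + 1) ≤ q / s := by gcongr
  have h2 : 5 * ((j : ℝ) + 1) * (j + 1 - s) / (s * (s + 1)) * (q + 2 * q / (j + 1)) =
      5 * (((j + 1 : ℕ) : ℝ) + 1) * ((j + 1 : ℕ) + 1 - s) / (s * (s + 1)) * q - 5 * (q / s) := by
    push_cast
    field_simp
    ring
  rw [h2]
  have h3 : 4 * q / s = 4 * (q / s) := by ring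
  rw [h3]
  linarith

/-- The logarithm absorbs the main drift by log(1 + t) ≤ t; the telescoping term absorbs the rest,
since 8s/(J(J+1)) ≥ 4s/J² for J = j + 1 ≥ 1. -/
lemma offset_add_le {s j : ℕ} (hs : 1 ≤ s) (h : s ≤ j + 1) :
    offset s j - 4 / (j + 1) + 4 * s / ((j : ℝ) + 1) ^ 2 ≤ offset s (j + 1) := by
  have hs' : (0 : ℝ) < s := by exact_mod_cast hs
  rw [offset, offset, if_pos h, if_pos (by omega)]
  push_cast
  have hj : (0 : ℝ) < (j : ℝ) + 1 := by positivity
  have h1 : Real.log (((j : ℝ) + 1 + 1) / s) ≤ Real.log (((j : ℝ) + 1) / s) + 1 / (j + 1) := by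
    have e : ((j : ℝ) + 1 + 1) / s = ((j : ℝ) + 1) / s * (1 + 1 / (j + 1)) := by field_simp
    rw [e, Real.log_mul (by positivity) (by positivity)]
    have := Real.log_le_sub_one_of_pos (show (0 : ℝ) < 1 + 1 / ((j : ℝ) + 1) by positivity)
    linarith
  have h2 : 4 * (s : ℝ) / ((j : ℝ) + 1) ^ 2 ≤
      8 * s * (1 / ((j : ℝ) + 1) - 1 / ((j : ℝ) + 1 + 1)) := by
    have e : 8 * (s : ℝ) * (1 / ((j : ℝ) + 1) - 1 / ((j : ℝ) + 1 + 1)) =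
        8 * s / (((j : ℝ) + 1) * (j + 1 + 1)) := by
      field_simp
      ring
    rw [e, div_le_div_iff₀ (by positivity) (by positivity)]
    nlinarith [mul_pos hs' hj, mul_nonneg (mul_pos hs' hj).le (Nat.cast_nonneg j : (0 : ℝ) ≤ j)]
  have h3 : 4 / ((j : ℝ) + 1) = 4 * (1 / (j + 1)) := by ring
  rw [h3]
  linarith

/-- Used when few clusters remain: losing a factor 2 is harmless there, but no quadratic error is
affordable. -/
lemma half_mul_le_log_one_add {x : ℝ} (h0 : 0 ≤ x) (h1 : x ≤ 1) :
    x / 2 ≤ Real.log (1 + x) := by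
  refine le_trans ?_ (Real.le_log_one_add_of_nonneg h0)
  rw [div_le_div_iff₀ (by norm_num) (by linarith)]
  nlinarith

/-- Used when many clusters remain: the linear coefficient must be exact, so that the accumulated
drift cancels the initial log n. -/
lemma sub_sq_div_two_le_log_one_add {x : ℝ} (h0 : 0 ≤ x) : x - x ^ 2 / 2 ≤ Real.log (1 + x) := by
  refine le_trans ?_ (Real.le_log_one_add_of_nonneg h0)
  rw [le_div_iff₀ (by linarith)]
  nlinarith [pow_nonneg h0 3]

/-- The drift of the logarithm, in terms of `q = ∑ (x / n) ^ 2` and of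
`κ = ∑ (x / n) ^ 3 / q`. -/
lemma drift_inequality {s j : ℕ} (hs : 1 ≤ s) {q κ : ℝ} (hq0 : 0 ≤ q) (hq1 : q ≤ 1)
    (hκ0 : 0 ≤ κ) (hκ : κ ≤ √q) :
    ∃ u v : ℝ, 0 ≤ v ∧ (∀ x : ℝ, 0 ≤ x → x ≤ 1 → -2 * Real.log (1 + x) ≤ -2 * u * x + v * x ^ 2) ∧
      |(1 - q) / (j + 1) - target s (j + 1)| - 4 * u * ((1 - κ) / (j + 1)) +
        4 * v * (κ / (j + 1)) + slope s j * (q + 2 * q * (1 - κ) / (j + 1)) + offset s j ≤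
        slope s (j + 1) * q + offset s (j + 1) := by
  have hj : (0 : ℝ) < (j : ℝ) + 1 := by positivity
  have hr0 := Real.sqrt_nonneg q
  have hr2 : √q ^ 2 = q := Real.sq_sqrt hq0
  set r := √q
  by_cases h : s ≤ j + 1
  · refine ⟨1, 1, zero_le_one, fun x h0 _ => ?_, ?_⟩
    · linarith [sub_sq_div_two_le_log_one_add h0]
    · have hs' : (0 : ℝ) < s := by exact_mod_cast hs
      have e1 : (1 - q) / ((j : ℝ) + 1) - target s (j + 1) = -(q / (j + 1)) := by
        rw [target, if_pos h]
        push_cast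
        ring
      rw [e1, abs_neg, abs_of_nonneg (by positivity)]
      have h1 := slope_add_le hs h hq0
      have h2 := offset_add_le hs h
      have h3 : slope s j * (q + 2 * q * (1 - κ) / (j + 1)) ≤
          slope s j * (q + 2 * q / (j + 1)) := by
        apply mul_le_mul_of_nonneg_left _ (slope_nonneg s j)
        have : 2 * q * (1 - κ) ≤ 2 * q := by nlinarith
        gcongr
      -- Four of the eight come from the factor 1 - κ and four from the quadratic term. The weights
      -- of this AM-GM match `slope_add_le` and `offset_add_le`.
      have h4 : 8 * (κ / ((j : ℝ) + 1)) ≤ 4 * q / s + 4 * s / ((j : ℝ) + 1) ^ 2 := by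
        have e2 : 4 * q / s + 4 * s / ((j : ℝ) + 1) ^ 2 - 8 * (r / ((j : ℝ) + 1)) =
            4 * (r * (j + 1) - s) ^ 2 / (s * ((j : ℝ) + 1) ^ 2) := by
          rw [← hr2]
          field_simp
          ring
        have e3 : 0 ≤ 4 * (r * (j + 1) - s) ^ 2 / (s * ((j : ℝ) + 1) ^ 2) := by positivity
        have e4 : κ / ((j : ℝ) + 1) ≤ r / (j + 1) := by gcongr
        linarith
      have h5 : (1 - κ) / ((j : ℝ) + 1) = 1 / (j + 1) - κ / (j + 1) := by ring
      have h6 : 4 / ((j : ℝ) + 1) = 4 * (1 / (j + 1)) := by ring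
      rw [h5]
      rw [h6] at h2
      linarith
  · refine ⟨1 / 2, 0, le_rfl, fun x h0 h1 => ?_, ?_⟩
    · linarith [half_mul_le_log_one_add h0 h1]
    · have e1 : slope s j = 0 := if_neg h
      have e2 : offset s j = 0 := if_neg h
      -- At the boundary s = j + 2 the nontrivial formulas already apply, but both vanish there.
      have e3 : slope s (j + 1) = 0 ∧ offset s (j + 1) = 0 := by
        rw [slope, offset]
        split_ifs with h'
        · have : s = j + 1 + 1 := by omega
          subst this
          push_cast
          constructor
          · simp
          · rw [div_self (by positivity)]
            simp
        · simp
      have e4 : target s (j + 1) = 0 := if_neg h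
      rw [e1, e2, e3.1, e3.2, e4, sub_zero,
        abs_of_nonneg (div_nonneg (by linarith) hj.le)]
      -- 1 - q = (1 - √q)(1 + √q) ≤ 2(1 - √q) ≤ 2(1 - κ).
      have : (1 - q) / ((j : ℝ) + 1) ≤ 2 * ((1 - κ) / (j + 1)) := by
        rw [← mul_div_assoc]
        gcongr
        nlinarith
      linarith

/-- A state of the chain, with the normalized cost so far, the sum of the conditional
means of its increments, and the total distance of these to their targets. -/
structure AugState where
  /-- the cluster sizes -/
  sizes : Multiset ℕ
  /-- the normalized cost -/
  cost : ℝ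
  /-- the compensator of the normalized cost -/
  drift : ℝ
  /-- the total distance of the increments of the compensator to their targets -/
  gap : ℝ

/-- The mean normalized cost of the next jump. -/
def meanPrey (n : ℕ) (m : Multiset ℕ) : ℝ :=
  (1 - powerSum 2 m / (n : ℝ) ^ 2) / ((m.card : ℝ) - 1)

/-- The effect of a jump and of a pick. -/
def augStep (n s : ℕ) (σ : AugState) (a : (ℕ × ℕ) × ℕ) : AugState where
  sizes := merge σ.sizes a.1.1 a.1.2
  cost := σ.cost + ((a.1.1 : ℝ) + a.1.2 - a.2) / n
  drift := σ.drift + meanPrey n σ.sizes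
  gap := σ.gap + |meanPrey n σ.sizes - target s (σ.sizes.card - 1)|

/-- A supermartingale when `j` is the number of remaining jumps. -/
def potential (n s j : ℕ) (σ : AugState) : ℝ :=
  (σ.cost - σ.drift) ^ 2 + (1 - powerSum 2 σ.sizes / (n : ℝ) ^ 2) / 2 + σ.gap -
    2 * Real.log (powerSum 2 σ.sizes / (n : ℝ) ^ 2) +
    slope s j * (powerSum 2 σ.sizes / (n : ℝ) ^ 2) + offset s j

/-- The term (1 - q)/2 pays for the squared martingale increment; the logarithm, slope and offset
pay for the gap through `drift_inequality`. -/
lemma potential_supermartingale {n s j : ℕ} (hn : 1 ≤ n) (hs : 1 ≤ s) (σ : AugState)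
    (h : IsState n (j + 1) σ.sizes) :
    ∑ a ∈ pickSupport n, pickWeight n σ.sizes a * potential n s j (augStep n s σ a) ≤
      potential n s (j + 1) σ := by
  have hn' : (0 : ℝ) < n := by positivity
  have hj : (0 : ℝ) < (j : ℝ) + 1 := by positivity
  have hQ0 := h.powerSum_two_pos
  have hQn := h.powerSum_two_le
  have hC0 := powerSum_nonneg 3 σ.sizes
  have hC := powerSum_three_le σ.sizes
  have hF0 := powerSum_nonneg 5 σ.sizes
  have hmean : meanPrey n σ.sizes = (1 - powerSum 2 σ.sizes / (n : ℝ) ^ 2) / ((j : ℝ) + 1) := by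
    rw [meanPrey, h.card_eq]
    push_cast
    ring
  have hcard : σ.sizes.card - 1 = j + 1 := by rw [h.card_eq]; rfl
  set m := σ.sizes with hm
  set Q := powerSum 2 m with hQ
  set C := powerSum 3 m
  set F := powerSum 5 m
  have hq0 : 0 < Q / (n : ℝ) ^ 2 := by positivity
  have hq1 : Q / (n : ℝ) ^ 2 ≤ 1 := (div_le_one (by positivity)).2 hQn
  have hκ0 : 0 ≤ C / (n * Q) := by positivity
  have hκ : C / (n * Q) ≤ √(Q / (n : ℝ) ^ 2) := by
    rw [Real.sqrt_div hQ0.le, Real.sqrt_sq hn'.le, div_le_div_iff₀ (by positivity) hn']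
    nlinarith
  obtain ⟨u, v, hv, hlog, hdrift⟩ := drift_inequality (s := s) (j := j) hs hq0.le hq1 hκ0 hκ
  set r := meanPrey n m with hr
  set z := σ.cost - σ.drift with hz
  set g := |r - target s (j + 1)| with hg
  rw [← hmean, ← hg] at hdrift
  set A := slope s j
  -- Bounding the logarithm by a quadratic makes the new potential a polynomial in L and R, whose
  -- mean is explicit; the increment of q enters through LR = xy.
  have hpoint : ∀ a ∈ pickSupport n, pickWeight n m a * potential n s j (augStep n s σ a) ≤
      pickWeight n m a *
      (((z - r) ^ 2 + (1 - Q / (n : ℝ) ^ 2) / 2 + σ.gap + g - 2 * Real.log (Q / (n : ℝ) ^ 2) +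
          A * (Q / (n : ℝ) ^ 2) + offset s j) +
        (2 * (z - r) / n) * (a.1.1 + a.1.2 - a.2 : ℕ) +
        (1 / (n : ℝ) ^ 2) * ((a.1.1 + a.1.2 - a.2 : ℕ) : ℝ) ^ 2 +
        (-1 / (n : ℝ) ^ 2 - 4 * u / Q + 2 * A / (n : ℝ) ^ 2) *
          (a.2 * (a.1.1 + a.1.2 - a.2 : ℕ)) +
        (4 * v / Q ^ 2) * ((a.2 : ℝ) * (a.1.1 + a.1.2 - a.2 : ℕ)) ^ 2) := by
    rintro ⟨⟨x, y⟩, l⟩ -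
    by_cases hw : pickWeight n m ((x, y), l) = 0
    · simp [hw]
    apply mul_le_mul_of_nonneg_left _ (pickWeight_nonneg _ _ _)
    have hle : ({x, y} : Multiset ℕ) ≤ m :=
      pair_le_of_pairWeight_ne_zero (pairWeight_ne_zero_of_pickWeight_ne_zero hw)
    have hl : l = x ∨ l = y := eq_or_eq_of_pickWeight_ne_zero hw
    have hle' : l ≤ x + y := by omega
    have hprod : (l : ℝ) * (x + y - l) = x * y := by
      rcases hl with rfl | rfl <;> ring
    have hsq := sq_add_sq_le_powerSum_two hle
    simp only [potential, augStep, ← hm, ← hr, hcard, ← hg, powerSum_two_merge hle, ← hQ]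
    rw [Nat.cast_sub hle', Nat.cast_add, hprod]
    have hx0 : (0 : ℝ) ≤ 2 * (x * y) / Q := by positivity
    have hx1 : 2 * ((x : ℝ) * y) / Q ≤ 1 := by
      rw [div_le_one hQ0]
      nlinarith [sq_nonneg ((x : ℝ) - y)]
    have hL := hlog _ hx0 hx1
    have e1 : Real.log ((Q + 2 * ((x : ℝ) * y)) / (n : ℝ) ^ 2) =
        Real.log (Q / (n : ℝ) ^ 2) + Real.log (1 + 2 * (x * y) / Q) := by
      rw [← Real.log_mul hq0.ne' (by positivity)]
      congr 1
      field_simp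
    rw [e1]
    have e2 : σ.cost + ((x : ℝ) + y - l) / n - (σ.drift + r) = z - r + (x + y - l) / n := by
      rw [hz]; ring
    rw [e2]
    have e3 : -2 * u * (2 * ((x : ℝ) * y) / Q) + v * (2 * ((x : ℝ) * y) / Q) ^ 2 =
      -4 * u / Q * (x * y) + 4 * v / Q ^ 2 * (x * y) ^ 2 := by ring
    have e4 : (z - r + ((x : ℝ) + y - l) / n) ^ 2 = (z - r) ^ 2 +
      2 * (z - r) / n * (x + y - l) + 1 / (n : ℝ) ^ 2 * (x + y - l) ^ 2 := by ring
    have e5 : (Q + 2 * ((x : ℝ) * y)) / (n : ℝ) ^ 2 = Q / (n : ℝ) ^ 2 +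
      2 / (n : ℝ) ^ 2 * (x * y) := by ring
    have e6 : (-1 / (n : ℝ) ^ 2 - 4 * u / Q + 2 * A / (n : ℝ) ^ 2) * (x * y) =
      -(1 / (n : ℝ) ^ 2 * (x * y)) - 4 * u / Q * (x * y) +
        A * (2 / (n : ℝ) ^ 2 * (x * y)) := by ring
    have e7 : 2 / (n : ℝ) ^ 2 * ((x : ℝ) * y) = 2 * (1 / (n : ℝ) ^ 2 * (x * y)) := by ring
    have e8 : -4 * u / Q * ((x : ℝ) * y) = -(4 * u / Q * (x * y)) := by ring
    rw [e3, e8] at hL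
    rw [e4, e5, e6, mul_add A]
    linarith
  refine (Finset.sum_le_sum hpoint).trans ?_
  rw [sum_pickWeight_mul_polynomial h hn]
  have f1 : 2 * (z - r) / n * (((n : ℝ) ^ 2 - Q) / (n * (j + 1))) = 2 * (z - r) * r := by
    rw [hmean]
    field_simp
  -- The variance term 1/n² cancels against the contribution of (1 - q)/2.
  have f2 : (1 / (n : ℝ) ^ 2 + (-1 / (n : ℝ) ^ 2 - 4 * u / Q + 2 * A / (n : ℝ) ^ 2)) *
      ((n * Q - C) / (n * (j + 1))) = -(4 * u * ((1 - C / (n * Q)) / (j + 1))) +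
        A * (2 * (Q / (n : ℝ) ^ 2) * (1 - C / (n * Q)) / (j + 1)) := by
    field_simp
    ring
  -- The fifth power sum has a favourable sign and is dropped.
  have f3 : 4 * v / Q ^ 2 * ((C * Q - F) / (n * (j + 1))) ≤
      4 * v * (C / (n * Q) / (j + 1)) := by
    have : 4 * v * (C / (n * Q) / (j + 1)) = 4 * v / Q ^ 2 * ((C * Q) / (n * (j + 1))) := by
      field_simp
    rw [this]
    gcongr
    linarith
  have f4 : (z - r) ^ 2 + 2 * (z - r) * r ≤ z ^ 2 := by nlinarith [sq_nonneg r]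
  rw [f1, f2, potential, ← hz, ← hm, ← hQ]
  rw [mul_add A] at hdrift
  linarith

/-- The relations between the components of a state from which `j` jumps remain. -/
structure AugState.Valid (n s j : ℕ) (σ : AugState) : Prop where
  isState : IsState n j σ.sizes
  drift_near : |σ.drift - ∑ i ∈ Finset.Ico (j + 1) n, target s i| ≤ σ.gap
  gap_le : σ.gap ≤ ∑ i ∈ Finset.Ico (j + 1) n, (1 : ℝ) / i

/-- The conditional mean and its target both lie in [0, 1/(j+1)], hence so does their distance. -/
lemma AugState.Valid.step {n s j : ℕ} (hn : 1 ≤ n) {σ : AugState} (h : σ.Valid n s (j + 1))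
    {a : (ℕ × ℕ) × ℕ} (ha : pickWeight n σ.sizes a ≠ 0) : (augStep n s σ a).Valid n s j := by
  have hlt := h.isState.lt
  have hcard : σ.sizes.card - 1 = j + 1 := by rw [h.isState.card_eq]; rfl
  have hj : (0 : ℝ) < (j : ℝ) + 1 := by positivity
  have hI : Finset.Ico (j + 1) n = insert (j + 1) (Finset.Ico (j + 1 + 1) n) := by
    ext i
    simp only [Finset.mem_Ico, Finset.mem_insert]
    omega
  have hnot : j + 1 ∉ Finset.Ico (j + 1 + 1) n := by simp
  refine ⟨h.isState.merge (pair_le_of_pairWeight_ne_zero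
    (pairWeight_ne_zero_of_pickWeight_ne_zero ha)), ?_, ?_⟩
  · simp only [augStep, hcard]
    rw [hI, Finset.sum_insert hnot]
    have e : σ.drift + meanPrey n σ.sizes -
        (target s (j + 1) + ∑ i ∈ Finset.Ico (j + 1 + 1) n, target s i) =
        (σ.drift - ∑ i ∈ Finset.Ico (j + 1 + 1) n, target s i) +
          (meanPrey n σ.sizes - target s (j + 1)) := by ring
    rw [e]
    refine (abs_add_le _ _).trans ?_
    linarith [h.drift_near]
  · simp only [augStep, hcard]
    rw [hI, Finset.sum_insert hnot]
    have hn2 : (0 : ℝ) < (n : ℝ) ^ 2 := by positivity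
    have hQ0 : 0 ≤ powerSum 2 σ.sizes / (n : ℝ) ^ 2 :=
      div_nonneg h.isState.powerSum_two_pos.le hn2.le
    have hQ1 : powerSum 2 σ.sizes / (n : ℝ) ^ 2 ≤ 1 :=
      (div_le_one hn2).2 h.isState.powerSum_two_le
    have hm : meanPrey n σ.sizes =
        (1 - powerSum 2 σ.sizes / (n : ℝ) ^ 2) / ((j : ℝ) + 1) := by
      rw [meanPrey, h.isState.card_eq]
      push_cast
      ring
    have hm0 : 0 ≤ meanPrey n σ.sizes := by
      rw [hm]
      exact div_nonneg (by linarith) hj.le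
    have hm1 : meanPrey n σ.sizes ≤ 1 / ((j + 1 : ℕ) : ℝ) := by
      rw [hm, Nat.cast_add, Nat.cast_one]
      gcongr
      linarith
    have ht : 0 ≤ target s (j + 1) ∧ target s (j + 1) ≤ 1 / ((j + 1 : ℕ) : ℝ) := by
      rw [target]
      split_ifs
      · exact ⟨by positivity, le_rfl⟩
      · exact ⟨le_rfl, by positivity⟩
    have : |meanPrey n σ.sizes - target s (j + 1)| ≤ 1 / ((j + 1 : ℕ) : ℝ) :=
      abs_le.2 ⟨by linarith [ht.2], by linarith [ht.1]⟩
    linarith [h.gap_le]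

end Potential

/-! ### From the law of the process to sums over paths. -/

section Law

lemma preimage_finPath_singleton {Ω β : Type*} [Inhabited β] {j : ℕ} (Y : ℕ → Ω → β)
    (p : Fin j → β) :
    (fun ω (i : Fin j) => Y i ω) ⁻¹' {p} = {ω | ∀ k < j, Y k ω = extendPath p k} := by
  ext ω
  simp only [Set.mem_preimage, Set.mem_singleton_iff, Set.mem_ofPred_eq]
  constructor
  · rintro rfl k hk
    rw [extendPath_of_lt _ hk]
  · intro h
    funext i
    rw [h i i.2, extendPath_of_lt _ i.2]

variable {Ω : Type*} [MeasurableSpace Ω] {P : Measure Ω} {n : ℕ}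

lemma clusters_congr {x y x' y' : ℕ → ℕ} {k : ℕ} (h : ∀ i < k, x i = x' i ∧ y i = y' i) :
    clusters n x y k = clusters n x' y' k := by
  induction k with
  | zero => rfl
  | succ k ih =>
    rw [clusters, clusters, ih fun i hi => h i (by omega), (h k (by omega)).1,
      (h k (by omega)).2]

lemma traj_merge (a : ℕ → ℕ × ℕ) (k : ℕ) :
    traj (fun m a => merge m a.1 a.2) (Multiset.replicate n 1) a k =
      clusters n (fun i => (a i).1) (fun i => (a i).2) k := by
  induction k with
  | zero => rfl
  | succ k ih => rw [traj, ih, clusters]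

lemma traj_augStep (s : ℕ) (a : ℕ → (ℕ × ℕ) × ℕ) (k : ℕ) :
    (traj (augStep n s) ⟨Multiset.replicate n 1, 0, 0, 0⟩ a k).sizes =
      clusters n (fun i => (a i).1.1) (fun i => (a i).1.2) k ∧
    (traj (augStep n s) ⟨Multiset.replicate n 1, 0, 0, 0⟩ a k).cost =
      ∑ i ∈ Finset.range k, (((a i).1.1 : ℝ) + (a i).1.2 - (a i).2) / n := by
  induction k with
  | zero => exact ⟨rfl, by simp [traj]⟩
  | succ k ih =>
    constructor
    · rw [traj, augStep, clusters, ih.1]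
    · rw [traj, augStep, Finset.sum_range_succ, ih.2]

/-- The law of the sizes of the merging clusters. -/
lemma IsMarcusLushnikov.measure_sizes [IsProbabilityMeasure P] {X : ℝ≥0 → Ω → Multiset ℕ}
    {S s : ℕ → Ω → ℕ} {τ : ℕ → Ω → ℝ} (hX : IsMarcusLushnikov additiveKernel n P X S s τ)
    (hn : 1 ≤ n) (x y : ℕ → ℕ) :
    P {ω | ∀ k < n - 1, S k ω = x k ∧ s k ω = y k} =
      ∏ k ∈ Finset.range (n - 1),
        ENNReal.ofReal (pairWeight n (clusters n x y k) (x k, y k)) := by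
  set f : Multiset ℕ → ℕ × ℕ → Multiset ℕ := fun m a => merge m a.1 a.2
  set Y : Ω → Fin (n - 1) → ℕ × ℕ := fun ω i => (S i ω, s i ω) with hY
  have hYm : Measurable Y :=
    measurable_pi_lambda _ fun i => (hX.measurable_S i).prodMk (hX.measurable_s i)
  have hone : ∑' p : Fin (n - 1) → ℕ × ℕ,
      pathWeight (pairWeight n) f (Multiset.replicate n 1) (extendPath p) (n - 1) = 1 := by
    have := pathSum_one_eq_one (w := pairWeight n) (f := f) (Inv := IsState n)
      (fun _ => pairSupport n) (pairWeight_nonneg n)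
      (fun j m h a ha => by_contra fun h0 => ha (h.mem_pairSupport h0))
      (fun j m a h h0 => h.merge (pair_le_of_pairWeight_ne_zero h0))
      (fun j m h => sum_pairWeight h hn) (n - 1) _ (isState_replicate hn)
    simpa [pathSum] using this
  have htot : ∑' p : Fin (n - 1) → ℕ × ℕ, P (Y ⁻¹' {p}) = 1 := by
    have := tsum_measure_preimage_singleton (μ := P) (f := Y) (Set.to_countable Set.univ)
      fun p _ => hYm (measurableSet_singleton p)
    rw [Set.preimage_univ, measure_univ] at this
    rw [← this, tsum_univ fun p => P (Y ⁻¹' {p})]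
  have hpre : ∀ p, Y ⁻¹' {p} =
      {ω | ∀ k < n - 1, (S k ω, s k ω) = extendPath p k} := fun p =>
    preimage_finPath_singleton (fun k ω => (S k ω, s k ω)) p
  -- The law at times 0 also requires positive holding times, so it only gives a lower bound. Both
  -- families sum to one, which forces equality.
  have hle : ∀ p : Fin (n - 1) → ℕ × ℕ,
      pathWeight (pairWeight n) f (Multiset.replicate n 1) (extendPath p) (n - 1) ≤
        P (Y ⁻¹' {p}) := by
    intro p
    by_cases hp : ∀ k, (extendPath p k).2 ≤ (extendPath p k).1
    · have hl := hX.law (fun k => (extendPath p k).1) (fun k => (extendPath p k).2) (fun _ => 0)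
        hp (fun _ => le_rfl)
      have : pathWeight (pairWeight n) f (Multiset.replicate n 1) (extendPath p) (n - 1) =
          P {ω | ∀ k < n - 1, S k ω = (extendPath p k).1 ∧ s k ω = (extendPath p k).2 ∧
            0 < τ k ω} := by
        rw [hl, pathWeight]
        refine Finset.prod_congr rfl fun k _ => ?_
        rw [traj_merge, pairWeight, if_pos (hp k), mul_zero, Real.exp_zero, mul_one]
      rw [this, hpre]
      refine measure_mono fun ω hω k hk => ?_
      exact Prod.ext (hω k hk).1 (hω k hk).2.1
    · push Not at hp
      obtain ⟨k, hk⟩ := hp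
      -- The default pair is (0, 0), which is correctly ordered, so the violation occurs at an
      -- actual jump.
      have hkn : k < n - 1 := by
        by_contra h0
        rw [extendPath, dif_neg h0] at hk
        exact lt_irrefl 0 hk
      rw [pathWeight, Finset.prod_eq_zero (Finset.mem_range.2 hkn)]
      · exact zero_le
      · rw [pairWeight, if_neg (not_le.2 hk), ENNReal.ofReal_zero]
  have heq : ∀ p : Fin (n - 1) → ℕ × ℕ,
      pathWeight (pairWeight n) f (Multiset.replicate n 1) (extendPath p) (n - 1) =
        P (Y ⁻¹' {p}) := by
    intro p
    by_contra hne
    have := ENNReal.tsum_lt_tsum (by rw [hone]; exact ENNReal.one_ne_top) hle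
      (lt_of_le_of_ne (hle p) hne)
    rw [hone, htot] at this
    exact lt_irrefl _ this
  have hp := heq fun i => (x i, y i)
  rw [hpre] at hp
  have hext : ∀ k < n - 1, extendPath (fun i : Fin (n - 1) => (x i, y i)) k = (x k, y k) :=
    fun k hk => extendPath_of_lt _ hk
  have hset : {ω | ∀ k < n - 1, S k ω = x k ∧ s k ω = y k} = {ω | ∀ k < n - 1,
      (S k ω, s k ω) = extendPath (fun i : Fin (n - 1) => (x i, y i)) k} := by
    ext ω
    refine forall₂_congr fun k hk => ?_
    rw [hext k hk, Prod.mk.injEq]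
  rw [hset, ← hp, pathWeight]
  refine Finset.prod_congr rfl fun k hk => ?_
  have hk' := Finset.mem_range.1 hk
  rw [traj_merge, hext k hk', clusters_congr (x' := x) (y' := y)]
  intro i hi
  simp [hext i (hi.trans hk')]

/-- The expected cost functionals are sums over the paths. -/
lemma lintegral_cost_eq_pathSum [IsProbabilityMeasure P] {X : ℝ≥0 → Ω → Multiset ℕ}
    {S s L : ℕ → Ω → ℕ} {τ : ℕ → Ω → ℝ} (hX : IsMarcusLushnikov additiveKernel n P X S s τ)
    (hL : IsSizeBiasedPick n P S s L) (hn : 1 ≤ n) (r : ℕ) (G : ℝ → ℝ≥0∞) :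
    ∫⁻ ω, G (costQFB S s L (n - 1) ω / n) ∂P =
      pathSum (fun σ : AugState => pickWeight n σ.sizes) (augStep n r) (fun σ => G σ.cost) (n - 1)
        ⟨Multiset.replicate n 1, 0, 0, 0⟩ := by
  set Y : Ω → Fin (n - 1) → (ℕ × ℕ) × ℕ := fun ω i => ((S i ω, s i ω), L i ω) with hY
  have hYm : Measurable Y := measurable_pi_lambda _ fun i =>
    ((hX.measurable_S i).prodMk (hX.measurable_s i)).prodMk (hL.measurable_L i)
  set σ₀ : AugState := ⟨Multiset.replicate n 1, 0, 0, 0⟩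
  set F : (Fin (n - 1) → (ℕ × ℕ) × ℕ) → ℝ≥0∞ := fun p =>
    G (traj (augStep n r) σ₀ (extendPath p) (n - 1)).cost with hF
  have h1 : ∀ ω, G (costQFB S s L (n - 1) ω / n) = F (Y ω) := by
    intro ω
    rw [hF]
    simp only
    rw [(traj_augStep r _ _).2, costQFB, Finset.sum_div]
    congr 1
    refine Finset.sum_congr rfl fun k hk => ?_
    rw [extendPath_of_lt _ (Finset.mem_range.1 hk), preySize]
  simp_rw [h1]
  rw [← lintegral_map (measurable_of_countable F) hYm, lintegral_countable', pathSum]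
  refine tsum_congr fun p => ?_
  rw [Measure.map_apply hYm (measurableSet_singleton p), mul_comm]
  congr 1
  have hpre : Y ⁻¹' {p} = {ω | ∀ k < n - 1, S k ω = (extendPath p k).1.1 ∧
      s k ω = (extendPath p k).1.2 ∧ L k ω = (extendPath p k).2} := by
    rw [hY, preimage_finPath_singleton (fun k ω => ((S k ω, s k ω), L k ω)) p]
    ext ω
    refine forall₂_congr fun k hk => ?_
    rw [Prod.ext_iff, Prod.ext_iff, and_assoc]
  rw [hpre, hL.law (fun k => (extendPath p k).1.1) (fun k => (extendPath p k).1.2)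
    (fun k => (extendPath p k).2), hX.measure_sizes hn, ← Finset.prod_mul_distrib, pathWeight]
  refine Finset.prod_congr rfl fun k _ => ?_
  rw [(traj_augStep r _ _).1, pickWeight, ENNReal.ofReal_mul (pairWeight_nonneg _ _ _)]

end Law

/-! ### Harmonic sums, the initial potential and the final bound. -/

section Asymptotics

/-- The correction -1/k makes the induction close, by 1/(k+1) ≤ log(1 + 1/k) ≤ 1/k. -/
lemma log_div_le_sum_Ico {s k : ℕ} (hs : 1 ≤ s) (hk : s ≤ k) :
    Real.log ((k : ℝ) / s) ≤ ∑ i ∈ Finset.Ico s k, (1 : ℝ) / i ∧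
      ∑ i ∈ Finset.Ico s k, (1 : ℝ) / i ≤ Real.log ((k : ℝ) / s) + 1 / s - 1 / k := by
  have hs' : (0 : ℝ) < s := by exact_mod_cast hs
  induction k, hk using Nat.le_induction with
  | base => simp [div_self hs'.ne']
  | succ k hk ih =>
    have hk' : (0 : ℝ) < k := by exact_mod_cast (hs.trans hk)
    rw [Finset.sum_Ico_succ_top hk]
    have e : ((k + 1 : ℕ) : ℝ) / s = (k : ℝ) / s * (1 + 1 / k) := by
      push_cast
      field_simp
    rw [e, Real.log_mul (by positivity) (by positivity)]
    have h1 := Real.log_le_sub_one_of_pos (show (0 : ℝ) < 1 + 1 / k by positivity)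
    have h2 := Real.one_sub_inv_le_log_of_pos (show (0 : ℝ) < 1 + 1 / k by positivity)
    have h3 : 1 - (1 + 1 / (k : ℝ))⁻¹ = 1 / ((k + 1 : ℕ) : ℝ) := by
      push_cast
      field_simp
      ring
    rw [h3] at h2
    constructor
    · linarith [ih.1]
    · linarith [ih.2]

variable {n : ℕ}

lemma log_div_sqrt_bounds (hn : 1 ≤ n) :
    Real.log n / 2 ≤ Real.log ((n : ℝ) / Nat.sqrt n) ∧
      Real.log ((n : ℝ) / Nat.sqrt n) ≤ Real.log n / 2 + 1 := by
  have hn' : (0 : ℝ) < n := by exact_mod_cast hn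
  have hs : 1 ≤ Nat.sqrt n := Nat.le_sqrt.2 (by simpa using hn)
  have hs' : (1 : ℝ) ≤ Nat.sqrt n := by exact_mod_cast hs
  have h1 : (Nat.sqrt n : ℝ) ^ 2 ≤ n := by exact_mod_cast Nat.sqrt_le' n
  have h2 : (n : ℝ) ≤ (Nat.sqrt n + 1) ^ 2 := by
    exact_mod_cast (Nat.lt_succ_sqrt' n).le
  rw [Real.log_div hn'.ne' (by positivity)]
  have l1 := Real.log_le_log (by positivity) h1
  rw [Real.log_pow] at l1
  have l2 := Real.log_le_log hn' (h2.trans (show ((Nat.sqrt n : ℝ) + 1) ^ 2 ≤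
    (2 * Nat.sqrt n) ^ 2 by gcongr; linarith))
  rw [Real.log_pow, Real.log_mul (by norm_num) (by positivity)] at l2
  have l3 := Real.log_two_lt_d9
  push_cast at l1 l2
  constructor <;> linarith

lemma sum_target_eq {s : ℕ} (hs : 1 ≤ s) (hsn : s ≤ n) :
    ∑ i ∈ Finset.Ico 1 n, target s i = ∑ i ∈ Finset.Ico s n, (1 : ℝ) / i := by
  rw [← Finset.sum_Ico_consecutive _ hs hsn, Finset.sum_eq_zero, zero_add]
  · refine Finset.sum_congr rfl fun i hi => ?_
    rw [target, if_pos (Finset.mem_Ico.1 hi).1]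
  · intro i hi
    rw [target, if_neg (not_le.2 (Finset.mem_Ico.1 hi).2)]

/-- The limit 1/2 arises here: cutting the harmonic sum at √n leaves half of log n. -/
lemma abs_sum_target_sub_le (hn : 1 ≤ n) :
    |∑ i ∈ Finset.Ico 1 n, target (Nat.sqrt n) i - Real.log n / 2| ≤ 2 := by
  have hs : 1 ≤ Nat.sqrt n := Nat.le_sqrt.2 (by simpa using hn)
  have hs' : (1 : ℝ) ≤ Nat.sqrt n := by exact_mod_cast hs
  have h1 := log_div_le_sum_Ico hs (Nat.sqrt_le_self n)
  have h2 := log_div_sqrt_bounds hn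
  rw [sum_target_eq hs (Nat.sqrt_le_self n)]
  have h3 : (1 : ℝ) / Nat.sqrt n ≤ 1 := (div_le_one (by linarith)).2 hs'
  have h4 : (0 : ℝ) ≤ 1 / n := by positivity
  exact abs_le.2 ⟨by linarith [h1.1, h2.1], by linarith [h1.2, h2.2]⟩

/-- Initially q = 1/n, so -2 log q = 2 log n, which -4 log(n/s) cancels by the choice of s. The rest
is at most 1/2 + 5 + 8, the 5 coming from n - s ≤ s(s + 1). -/
lemma potential_start_le (hn : 1 ≤ n) :
    potential n (Nat.sqrt n) (n - 1) ⟨Multiset.replicate n 1, 0, 0, 0⟩ ≤ 14 := by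
  have hn' : (0 : ℝ) < n := by exact_mod_cast hn
  have hs : 1 ≤ Nat.sqrt n := Nat.le_sqrt.2 (by simpa using hn)
  have hs' : (1 : ℝ) ≤ Nat.sqrt n := by exact_mod_cast hs
  have hsn := Nat.sqrt_le_self n
  have hq : powerSum 2 (Multiset.replicate n 1) / (n : ℝ) ^ 2 = 1 / n := by
    simp [powerSum]
    field_simp
  have hcast : ((n - 1 : ℕ) : ℝ) + 1 = n := by
    rw [Nat.cast_sub hn]
    simp
  have h2 : (n : ℝ) ≤ Nat.sqrt n * Nat.sqrt n + Nat.sqrt n + Nat.sqrt n := by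
    exact_mod_cast Nat.sqrt_le_add n
  simp only [potential, hq, slope, offset, hcast, show n - 1 + 1 = n by omega, hsn, if_true]
  have h3 := (log_div_sqrt_bounds hn).1
  have h4 : 5 * (n : ℝ) * (n - Nat.sqrt n) / (Nat.sqrt n * (Nat.sqrt n + 1)) * (1 / n) ≤ 5 := by
    have e : 5 * (n : ℝ) * (n - Nat.sqrt n) / (Nat.sqrt n * (Nat.sqrt n + 1)) * (1 / n) =
        5 * (n - Nat.sqrt n) / (Nat.sqrt n * (Nat.sqrt n + 1)) := by
      field_simp
    rw [e, div_le_iff₀ (by positivity)]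
    nlinarith
  have h5 : 8 * (Nat.sqrt n : ℝ) * (1 / Nat.sqrt n - 1 / n) ≤ 8 := by
    have e : 8 * (Nat.sqrt n : ℝ) * (1 / Nat.sqrt n - 1 / n) = 8 - 8 * (Nat.sqrt n / n) := by
      field_simp
    have : (0 : ℝ) ≤ Nat.sqrt n / n := by positivity
    linarith
  have h6 : Real.log (1 / (n : ℝ)) = -Real.log n := by
    rw [one_div, Real.log_inv]
  have h7 : (0 : ℝ) ≤ 1 / n := by positivity
  rw [h6]
  linarith

/-- The mean square distance of the normalized cost to its deterministic approximation. -/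
lemma lintegral_cost_sub_sq_le {Ω : Type*} [MeasurableSpace Ω] {P : Measure Ω}
    [IsProbabilityMeasure P] {X : ℝ≥0 → Ω → Multiset ℕ} {S s L : ℕ → Ω → ℕ} {τ : ℕ → Ω → ℝ}
    (hX : IsMarcusLushnikov additiveKernel n P X S s τ) (hL : IsSizeBiasedPick n P S s L)
    (hn : 2 ≤ n) :
    ∫⁻ ω, ENNReal.ofReal ((costQFB S s L (n - 1) ω / n -
      ∑ i ∈ Finset.Ico 1 n, target (Nat.sqrt n) i) ^ 2) ∂P ≤
      ENNReal.ofReal (28 * (1 + Real.log n)) := by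
  have hn1 : 1 ≤ n := by omega
  have hs : 1 ≤ Nat.sqrt n := Nat.le_sqrt.2 (by simpa using hn1)
  set B := ∑ i ∈ Finset.Ico 1 n, target (Nat.sqrt n) i with hB
  set H := ∑ i ∈ Finset.Ico 1 n, (1 : ℝ) / i with hH
  have hH1 : 1 ≤ H := by
    have := Finset.single_le_sum (f := fun i : ℕ => (1 : ℝ) / i) (s := Finset.Ico 1 n)
      (fun i _ => by positivity) (Finset.mem_Ico.2 ⟨le_rfl, by omega⟩ : 1 ∈ Finset.Ico 1 n)
    rw [Nat.cast_one, div_one] at this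
    exact this
  have hHn : H ≤ 1 + Real.log n := by
    have := (log_div_le_sum_Ico (le_refl 1) hn1).2
    have h0 : (0 : ℝ) ≤ 1 / n := by positivity
    simp only [Nat.cast_one, div_one] at this
    linarith
  have hvalid : AugState.Valid n (Nat.sqrt n) (n - 1) ⟨Multiset.replicate n 1, 0, 0, 0⟩ := by
    have e : n - 1 + 1 = n := by omega
    exact ⟨isState_replicate hn1, by simp [e], by simp [e]⟩
  have hmain := pathSum_le_of_supermartingale (w := fun σ : AugState => pickWeight n σ.sizes)
    (f := augStep n (Nat.sqrt n)) (Inv := AugState.Valid n (Nat.sqrt n))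
    (fun _ => pickSupport n) (fun σ => (σ.cost - B) ^ 2)
    (fun j σ => 2 * H * potential n (Nat.sqrt n) j σ)
    (fun σ => pickWeight_nonneg n σ.sizes)
    (fun j σ h a ha => by_contra fun h0 => ha (h.isState.mem_pickSupport h0))
    (fun j σ a h h0 => h.step hn1 h0)
    (fun σ h => ⟨sq_nonneg _, ?_⟩)
    (fun j σ h => ?_) (n - 1) _ hvalid
  · rw [lintegral_cost_eq_pathSum hX hL hn1 (Nat.sqrt n)
      (fun c => ENNReal.ofReal ((c - B) ^ 2))]
    refine hmain.2.trans (ENNReal.ofReal_le_ofReal ?_)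
    have := potential_start_le hn1
    nlinarith
  · have hn2 : (0 : ℝ) < (n : ℝ) ^ 2 := by positivity
    have hq0 : 0 < powerSum 2 σ.sizes / (n : ℝ) ^ 2 := div_pos h.isState.powerSum_two_pos hn2
    have hq1 : powerSum 2 σ.sizes / (n : ℝ) ^ 2 ≤ 1 :=
      (div_le_one hn2).2 h.isState.powerSum_two_le
    have hlog := Real.log_nonpos hq0.le hq1
    -- When s = 1 the nontrivial formula applies at j = 0, and gives 0 as well.
    have hoff : offset (Nat.sqrt n) 0 = 0 := by
      rw [offset]
      split_ifs with h1
      · have : Nat.sqrt n = 1 := by omega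
        rw [this]
        simp
      · rfl
    have hslope := mul_nonneg (slope_nonneg (Nat.sqrt n) 0) hq0.le
    have hd1 := h.drift_near
    have hd2 := h.gap_le
    rw [zero_add] at hd1 hd2
    rw [← hB] at hd1
    rw [← hH] at hd2
    have hd0 : 0 ≤ σ.gap := (abs_nonneg _).trans hd1
    have hsq : (σ.drift - B) ^ 2 ≤ σ.gap ^ 2 := sq_le_sq' (abs_le.1 hd1).1 (abs_le.1 hd1).2
    have hpot : (σ.cost - σ.drift) ^ 2 + σ.gap ≤ potential n (Nat.sqrt n) 0 σ := by
      rw [potential, hoff]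
      linarith
    -- The pathwise bound gap² ≤ H · gap lets a first moment of the gap control a second moment; H ≥
    -- 1 lets the factor 2H serve the martingale term too.
    calc (σ.cost - B) ^ 2 ≤ 2 * (σ.cost - σ.drift) ^ 2 + 2 * (σ.drift - B) ^ 2 := by
          nlinarith [sq_nonneg ((σ.cost - σ.drift) - (σ.drift - B))]
      _ ≤ 2 * H * ((σ.cost - σ.drift) ^ 2 + σ.gap) := by
          nlinarith [mul_nonneg (sub_nonneg.2 hH1) (sq_nonneg (σ.cost - σ.drift)),
            mul_nonneg hd0 (sub_nonneg.2 hd2)]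
      _ ≤ _ := by gcongr
  · have := potential_supermartingale hn1 hs σ h.isState
    calc ∑ a ∈ pickSupport n, pickWeight n σ.sizes a *
          (2 * H * potential n (Nat.sqrt n) j (augStep n (Nat.sqrt n) σ a))
        = 2 * H * ∑ a ∈ pickSupport n, pickWeight n σ.sizes a *
          potential n (Nat.sqrt n) j (augStep n (Nat.sqrt n) σ a) := by
          rw [Finset.mul_sum (pickSupport n)]
          exact Finset.sum_congr rfl fun a _ => by ring
      _ ≤ _ := by gcongr

/-- Replacing the deterministic sum by (log n)/2 costs at most 2, whence 8 = 2 · 2² and 56 = 2 · 28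
from (a + b)² ≤ 2a² + 2b². -/
lemma lintegral_normalized_cost_le {Ω : Type*} [MeasurableSpace Ω] {P : Measure Ω}
    [IsProbabilityMeasure P] {X : ℝ≥0 → Ω → Multiset ℕ} {S s L : ℕ → Ω → ℕ} {τ : ℕ → Ω → ℝ}
    (hX : IsMarcusLushnikov additiveKernel n P X S s τ) (hL : IsSizeBiasedPick n P S s L)
    (hn : 2 ≤ n) :
    ∫⁻ ω, ENNReal.ofReal ((costQFB S s L (n - 1) ω / ((n : ℝ) * Real.log n) - 1 / 2) ^ 2) ∂P ≤
      ENNReal.ofReal ((56 * (1 + Real.log n) + 8) / Real.log n ^ 2) := by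
  have hlog : 0 < Real.log n := Real.log_pos (by exact_mod_cast hn)
  have hn' : (0 : ℝ) < n := by positivity
  set B := ∑ i ∈ Finset.Ico 1 n, target (Nat.sqrt n) i with hB
  have hBn := abs_sum_target_sub_le (n := n) (by omega)
  rw [← hB] at hBn
  have hB2 : (B - Real.log n / 2) ^ 2 ≤ 2 ^ 2 := sq_le_sq' (abs_le.1 hBn).1 (abs_le.1 hBn).2
  have hpt : ∀ ω, ENNReal.ofReal
      ((costQFB S s L (n - 1) ω / ((n : ℝ) * Real.log n) - 1 / 2) ^ 2) ≤
      ENNReal.ofReal (2 / Real.log n ^ 2) *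
        ENNReal.ofReal ((costQFB S s L (n - 1) ω / n - B) ^ 2) +
      ENNReal.ofReal (8 / Real.log n ^ 2) := by
    intro ω
    rw [← ENNReal.ofReal_mul (by positivity), ← ENNReal.ofReal_add (by positivity) (by positivity)]
    apply ENNReal.ofReal_le_ofReal
    set c := costQFB S s L (n - 1) ω
    have e : (c / ((n : ℝ) * Real.log n) - 1 / 2) ^ 2 =
        (c / n - Real.log n / 2) ^ 2 / Real.log n ^ 2 := by
      field_simp
    have e2 : 2 / Real.log n ^ 2 * (c / n - B) ^ 2 + 8 / Real.log n ^ 2 =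
        (2 * (c / n - B) ^ 2 + 8) / Real.log n ^ 2 := by ring
    rw [e, e2]
    gcongr
    nlinarith [sq_nonneg ((c / n - B) - (B - Real.log n / 2))]
  calc _ ≤ ∫⁻ ω, (ENNReal.ofReal (2 / Real.log n ^ 2) *
        ENNReal.ofReal ((costQFB S s L (n - 1) ω / n - B) ^ 2) +
        ENNReal.ofReal (8 / Real.log n ^ 2)) ∂P := lintegral_mono hpt
    _ = ENNReal.ofReal (2 / Real.log n ^ 2) *
        (∫⁻ ω, ENNReal.ofReal ((costQFB S s L (n - 1) ω / n - B) ^ 2) ∂P) +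
        ENNReal.ofReal (8 / Real.log n ^ 2) := by
      rw [lintegral_add_right _ measurable_const, lintegral_const_mul' _ _ ENNReal.ofReal_ne_top,
        lintegral_const, measure_univ, mul_one]
    _ ≤ ENNReal.ofReal (2 / Real.log n ^ 2) * ENNReal.ofReal (28 * (1 + Real.log n)) +
        ENNReal.ofReal (8 / Real.log n ^ 2) := by
      gcongr
      exact lintegral_cost_sub_sq_le hX hL hn
    _ = _ := by
      rw [← ENNReal.ofReal_mul (by positivity),
        ← ENNReal.ofReal_add (by positivity) (by positivity)]
      congr 1
      ring

lemma tendsto_error_zero :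
    Tendsto (fun n : ℕ => (56 * (1 + Real.log n) + 8) / Real.log n ^ 2) atTop (𝓝 0) := by
  have hl : Tendsto (fun n : ℕ => (Real.log n)⁻¹) atTop (𝓝 0) :=
    tendsto_inv_atTop_zero.comp (Real.tendsto_log_atTop.comp tendsto_natCast_atTop_atTop)
  have h : Tendsto (fun n : ℕ => 64 * (Real.log n)⁻¹ ^ 2 + 56 * (Real.log n)⁻¹) atTop
      (𝓝 (64 * 0 ^ 2 + 56 * 0)) := ((hl.pow 2).const_mul 64).add (hl.const_mul 56)
  rw [show (64 * 0 ^ 2 + 56 * 0 : ℝ) = 0 by norm_num] at h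
  refine h.congr' ?_
  filter_upwards [eventually_ge_atTop 2] with n hn
  have hlog : 0 < Real.log n := Real.log_pos (by exact_mod_cast hn)
  field_simp
  ring

end Asymptotics

end MarcusLushnikov

end

theorem mainTheorem4 {Ω : ℕ → Type*} [∀ n, MeasurableSpace (Ω n)]
    (P : ∀ n, Measure (Ω n)) [∀ n, IsProbabilityMeasure (P n)]
    (X : ∀ n, ℝ≥0 → Ω n → Multiset ℕ) (S s : ∀ n, ℕ → Ω n → ℕ)
    (τ : ∀ n, ℕ → Ω n → ℝ) (L : ∀ n, ℕ → Ω n → ℕ)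
    (hX : ∀ n, MarcusLushnikov.IsMarcusLushnikov MarcusLushnikov.additiveKernel n (P n)
      (X n) (S n) (s n) (τ n))
    (hL : ∀ n, MarcusLushnikov.IsSizeBiasedPick n (P n) (S n) (s n) (L n)) :
    Tendsto (fun n : ℕ => eLpNorm (fun ω =>
        MarcusLushnikov.costQFB (S n) (s n) (L n) (n - 1) ω / ((n : ℝ) * Real.log n) - 1 / 2)
      2 (P n)) atTop (𝓝 0) := by
  have hbound : Tendsto (fun n : ℕ => ENNReal.ofReal
      ((56 * (1 + Real.log n) + 8) / Real.log n ^ 2) ^ (1 / 2 : ℝ)) atTop (𝓝 0) := by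
    have h := (ENNReal.continuous_rpow_const (y := 1 / 2)).continuousAt.tendsto.comp
      (ENNReal.tendsto_ofReal MarcusLushnikov.tendsto_error_zero)
    rw [ENNReal.ofReal_zero, ENNReal.zero_rpow_of_pos (by norm_num)] at h
    exact h
  refine tendsto_of_tendsto_of_tendsto_of_le_of_le' tendsto_const_nhds hbound
    (Eventually.of_forall fun n => zero_le) ?_
  filter_upwards [eventually_ge_atTop 2] with n hn
  rw [eLpNorm_eq_lintegral_rpow_enorm_toReal (by norm_num) (by norm_num)]
  refine ENNReal.rpow_le_rpow (le_trans (le_of_eq ?_)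
    (MarcusLushnikov.lintegral_normalized_cost_le (hX n) (hL n) hn)) (by norm_num)
  refine lintegral_congr fun ω => ?_
  rw [Real.enorm_eq_ofReal_abs, ENNReal.toReal_ofNat,
    ENNReal.ofReal_rpow_of_nonneg (abs_nonneg _) (by norm_num)]
  congr 1
  rw [Real.rpow_two, sq_abs]
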